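/- Let $\mathbb{D}$ be the open unit disc in $\mathbb{C}$, and let $H^2$ be the Hardy space of all holomorphic functions $f$ on $\mathbb{D}$ with $$\sup_{0\le r<1}\frac1{2\pi}\int_0^{2\pi}|f(re^{it})|^2\,dt<\infty .$$ Let $B$ be a Blaschke product, that is, $$B(z)=z^m\prod_{n}\frac{|a_n|}{a_n}\,\frac{a_n-z}{1-\overline{a_n}z}\qquad(z\in\mathbb{D}),$$ where $m\ge 0$ is an integer and $(a_n)$ is a finite (possibly empty) or infinite sequence, repetitions allowed, in $\mathbb{D}\setminus\{0\}$ with $\sum_n(1-|a_n|)<\infty$. Let $\varphi:\mathbb{D}\to\mathbb{D}$ be holomorphic, and let $C_\varphi f=f\circ\varphi$ be the composition operator. Put $BH^2=\{Bg: g\in H^2\}$. Then the following statements are equivalent: 1. $BH^2$ is invariant under $C_\varphi$, that is, $C_\varphi(BH^2)\subseteq BH^2$. 2. $\mathrm{mult}_B(w)\le \mathrm{mult}_{B\circ\varphi}(w)$ for every $w\in\mathbb{D}$ with $B(w)=0$. Here $\mathrm{mult}_f(w)$ is the order of vanishing of the holomorphic function $f$ at $w$; it is $0$ if $f(w)\ne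 0$, and $\infty$ if $f$ is identically zero on $\mathbb{D}$. -/

import Mathlib

/-- The open unit disc of `ℂ`. Functions on the disc are represented by functions `ℂ → ℂ`;
only their values on the disc matter in every notion below. -/
abbrev disc : Set ℂ := Metric.ball (0 : ℂ) 1

/-- `f` belongs to the Hardy space `H²` of the disc: `f` is holomorphic on the disc, and the means
`(1 / 2π) ∫₀^{2π} |f (r e^{it})|² dt` are bounded uniformly in `0 ≤ r < 1`. -/
structure MemH2 (f : ℂ → ℂ) : Prop where
  differentiableOn : DifferentiableOn ℂ f disc
  bounded_means : ∃ C : ℝ, ∀ r : ℝ, 0 ≤ r → r < 1 →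
    (2 * Real.pi)⁻¹ * ∫ t in (0 : ℝ)..(2 * Real.pi),
      ‖f ((r : ℂ) * Complex.exp ((t : ℂ) * Complex.I))‖ ^ 2 ≤ C

/-- The set `θ H² = {θ g : g ∈ H²}`, as functions on the disc. -/
def mulH2 (θ : ℂ → ℂ) : Set (ℂ → ℂ) :=
  {f | ∃ g : ℂ → ℂ, MemH2 g ∧ ∀ z ∈ disc, f z = θ z * g z}

/-- The composition operator `C_φ f = f ∘ φ`. -/
def compOperator (φ f : ℂ → ℂ) : ℂ → ℂ := f ∘ φ

/-- A holomorphic self-map of the disc. -/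
structure IsHolomorphicSelfMap (φ : ℂ → ℂ) : Prop where
  differentiableOn : DifferentiableOn ℂ φ disc
  mapsTo : Set.MapsTo φ disc disc

/-- The factor `(|a| / a) (a - z) / (1 - conj a * z)` of a Blaschke product. -/
noncomputable def blaschkeFactor (a z : ℂ) : ℂ :=
  ((‖a‖ : ℂ) / a) * ((a - z) / (1 - (starRingEnd ℂ) a * z))

/-- The Blaschke product `z ^ m * ∏ᵢ (|aᵢ| / aᵢ) (aᵢ - z) / (1 - conj aᵢ * z)`. -/
noncomputable def blaschkeProduct {ι : Type} (m : ℕ) (a : ι → ℂ) (z : ℂ) : ℂ :=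
  z ^ m * ∏' i, blaschkeFactor (a i) z

/-- `B` is (on the disc) a Blaschke product: its zeros other than `0` are listed, with
repetitions, by a family `a` of nonzero points of the disc with `∑ᵢ (1 - |aᵢ|) < ∞`. All the terms
of this sum are positive, so `ι` is automatically countable; it may be infinite, finite or empty
(for instance, the constant function `1` is a Blaschke product). -/
def IsBlaschkeProduct (B : ℂ → ℂ) : Prop :=
  ∃ (ι : Type) (m : ℕ) (a : ι → ℂ),
    (∀ i, a i ≠ 0) ∧ (∀ i, a i ∈ disc) ∧ (Summable fun i => 1 - ‖a i‖) ∧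
      ∀ z ∈ disc, B z = blaschkeProduct m a z

theorem norm_blaschkeFactor_sub_one_le {a z : ℂ} (h0 : a ≠ 0) (ha : a ∈ disc) (hz : z ∈ disc) :
    ‖blaschkeFactor a z - 1‖ ≤ (1 - ‖a‖) * (2 / (1 - ‖z‖)) := by
  simp only [disc, Metric.mem_ball, dist_zero_right] at ha hz
  have hpos : 0 < ‖a‖ := norm_pos_iff.mpr h0
  have hden : 1 - ‖z‖ ≤ ‖1 - (starRingEnd ℂ) a * z‖ := by
    have h1 := norm_sub_norm_le (1 : ℂ) ((starRingEnd ℂ) a * z)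
    rw [norm_one, norm_mul, RCLike.norm_conj] at h1
    nlinarith [norm_nonneg z]
  have hd0 : 1 - (starRingEnd ℂ) a * z ≠ 0 := by
    rw [← norm_pos_iff]; linarith
  have hsq : a * (starRingEnd ℂ) a = (‖a‖ : ℂ) ^ 2 := Complex.mul_conj' a
  have key : blaschkeFactor a z - 1 =
      -((1 - (‖a‖ : ℂ)) * (a + ‖a‖ * z) / (a * (1 - (starRingEnd ℂ) a * z))) := by
    unfold blaschkeFactor
    rw [div_mul_div_comm, div_sub_one (mul_ne_zero h0 hd0), ← neg_div]
    congr 1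
    linear_combination z * hsq
  have hone : ‖(1 : ℂ) - (‖a‖ : ℂ)‖ = 1 - ‖a‖ := by
    rw [← Complex.ofReal_one, ← Complex.ofReal_sub, Complex.norm_real, Real.norm_eq_abs,
      abs_of_pos (by linarith)]
  have hnum : ‖a + ‖a‖ * z‖ ≤ ‖a‖ * 2 := by
    refine (norm_add_le _ _).trans ?_
    rw [norm_mul, Complex.norm_real, norm_norm]
    nlinarith
  rw [key, norm_neg, norm_div, norm_mul, norm_mul, hone, mul_div_assoc]
  refine mul_le_mul_of_nonneg_left ?_ (by linarith)
  rw [div_le_div_iff₀ (by positivity) (by linarith)]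
  calc ‖a + ‖a‖ * z‖ * (1 - ‖z‖) ≤ (‖a‖ * 2) * ‖1 - (starRingEnd ℂ) a * z‖ :=
        mul_le_mul hnum hden (by linarith) (by positivity)
    _ = 2 * (‖a‖ * ‖1 - (starRingEnd ℂ) a * z‖) := by ring

/-- The product defining a Blaschke product converges at every point of the disc, so that the
value of `∏'` above is the genuine one. -/
theorem multipliable_blaschkeFactor {ι : Type} {a : ι → ℂ} (h0 : ∀ i, a i ≠ 0)
    (ha : ∀ i, a i ∈ disc) (hs : Summable fun i => 1 - ‖a i‖) {z : ℂ} (hz : z ∈ disc) :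
    Multipliable fun i => blaschkeFactor (a i) z := by
  have h : Summable fun i => ‖blaschkeFactor (a i) z - 1‖ :=
    Summable.of_nonneg_of_le (fun _ => norm_nonneg _)
      (fun i => norm_blaschkeFactor_sub_one_le (h0 i) (ha i) hz) (hs.mul_right _)
  simpa using multipliable_one_add_of_summable h

open Filter Topology Metric

/-! ### Littlewood subordination -/

/-! If `B H²` is invariant, then `B ∘ φ = B g` with `g` holomorphic, because `B = B · 1` lies in `B
H²`; orders of vanishing add, which gives the inequality.

Conversely, the order condition lets one divide: `B ∘ φ = B b` with `b` holomorphic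
(`AnalyticOnNhd.exists_eq_mul_of_analyticOrderAt_le`). The crux is `|b| ≤ 1`
(`exists_eq_blaschkeProduct_mul`): a finite subproduct of `B` has modulus tending to 1 at the
circle, so the maximum principle bounds `B ∘ φ` by it, and the limit over finite subproducts gives
`|B ∘ φ| ≤ |B|`. Then `(B g) ∘ φ = B · b · (g ∘ φ)`, where `g ∘ φ` is in `H²` by Littlewood
subordination (`MemH2.comp_selfMap`) and the bounded factor `b` preserves `H²`. -/

theorem two_pi_inv_mul_integral_eq_circleAverage (f : ℂ → ℂ) (r : ℝ) :
    (2 * Real.pi)⁻¹ * ∫ t in (0 : ℝ)..(2 * Real.pi),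
      ‖f ((r : ℂ) * Complex.exp ((t : ℂ) * Complex.I))‖ ^ 2 =
      Real.circleAverage (fun z => ‖f z‖ ^ 2) 0 r := by
  simp [Real.circleAverage, circleMap]

theorem memH2_iff_circleAverage {f : ℂ → ℂ} :
    MemH2 f ↔ DifferentiableOn ℂ f disc ∧ ∃ C : ℝ, ∀ r : ℝ, 0 ≤ r → r < 1 →
      Real.circleAverage (fun z => ‖f z‖ ^ 2) 0 r ≤ C := by
  simp_rw [← two_pi_inv_mul_integral_eq_circleAverage]
  exact ⟨fun h => ⟨h.1, h.2⟩, fun h => ⟨h.1, h.2⟩⟩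

theorem memH2_one : MemH2 fun _ => 1 :=
  memH2_iff_circleAverage.2 ⟨differentiableOn_const _, 1, fun r _ _ => by
    simp [Real.circleAverage_const]⟩

theorem circleIntegrable_of_continuousOn_disc {E : Type*} [NormedAddCommGroup E] {f : ℂ → E}
    (hf : ContinuousOn f disc) {r : ℝ} (h0 : 0 ≤ r) (h1 : r < 1) : CircleIntegrable f 0 r :=
  (hf.mono fun z hz => by
    simp only [mem_sphere_iff_norm, sub_zero] at hz
    simpa [hz] using h1).circleIntegrable h0

theorem MemH2.mul_bounded {f h : ℂ → ℂ} (hf : MemH2 f) (hd : DifferentiableOn ℂ h disc)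
    (hb : ∀ z ∈ disc, ‖h z‖ ≤ 1) : MemH2 fun z => h z * f z := by
  obtain ⟨hfd, C, hC⟩ := memH2_iff_circleAverage.1 hf
  refine memH2_iff_circleAverage.2 ⟨hd.mul hfd, C, fun r h0 h1 => ?_⟩
  refine le_trans (Real.circleAverage_mono ?_ ?_ fun z hz => ?_) (hC r h0 h1)
  · exact circleIntegrable_of_continuousOn_disc ((hd.mul hfd).continuousOn.norm.pow 2) h0 h1
  · exact circleIntegrable_of_continuousOn_disc (hfd.continuousOn.norm.pow 2) h0 h1
  · have hz' : z ∈ disc := by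
      simp only [mem_sphere_iff_norm, sub_zero, abs_of_nonneg h0] at hz
      simpa [hz] using h1
    rw [norm_mul]
    have := hb z hz'
    gcongr
    exact mul_le_of_le_one_left (norm_nonneg _) this

theorem norm_circleAverage_le {E : Type*} [NormedAddCommGroup E] [NormedSpace ℝ E]
    (f : ℂ → E) (c : ℂ) (R : ℝ) :
    ‖Real.circleAverage f c R‖ ≤ Real.circleAverage (fun z => ‖f z‖) c R := by
  rw [Real.circleAverage, Real.circleAverage, norm_smul, smul_eq_mul, Real.norm_eq_abs,
    abs_of_pos (inv_pos.2 Real.two_pi_pos)]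
  gcongr
  exact intervalIntegral.norm_integral_le_integral_norm Real.two_pi_pos.le

/-- The square of the modulus of a holomorphic function is at most its Poisson integral. -/
theorem norm_sq_le_re_circleAverage_herglotzRieszKernel {g : ℂ → ℂ}
    (hg : DifferentiableOn ℂ g disc) {R : ℝ} (hR1 : R < 1) {w : ℂ} (hw : w ∈ ball (0 : ℂ) R) :
    ‖g w‖ ^ 2 ≤ (Real.circleAverage
      (fun ζ => herglotzRieszKernel 0 w ζ • ((‖g ζ‖ ^ 2 : ℝ) : ℂ)) 0 R).re := by
  have hR0 : 0 < R := pos_of_mem_ball hw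
  have hsub : closedBall (0 : ℂ) R ⊆ disc := closedBall_subset_ball hR1
  have hint : CircleIntegrable (fun z => ‖g z‖ ^ 2) 0 R :=
    circleIntegrable_of_continuousOn_disc (hg.continuousOn.norm.pow 2) hR0.le hR1
  have hcl : DiffContOnCl ℂ (fun z => g z ^ 2) (ball 0 R) :=
    ((hg.pow 2).mono ((closure_ball_subset_closedBall).trans hsub)).diffContOnCl
  -- Poisson's formula for the holomorphic function `g ^ 2`; positivity of the Poisson kernel then
  -- lets the norm pass inside the average.
  rw [re_circleAverage_herglotzRieszKernel_smul hint hw, ← norm_pow,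
    ← hcl.circleAverage_re_herglotzRieszKernel_smul hw]
  refine (norm_circleAverage_le _ _ _).trans (le_of_eq ?_)
  refine Real.circleAverage_congr_sphere fun z hz => ?_
  rw [abs_of_pos hR0] at hz
  have hnn : 0 ≤ (herglotzRieszKernel 0 w z).re := by
    refine le_trans ?_ (le_re_herglotzRieszKernel hz hw)
    have : ‖w‖ < R := by simpa using hw
    rw [sub_zero]
    exact div_nonneg (by linarith) (by positivity)
  simp [abs_of_nonneg hnn]

/-- A Harnack estimate for Poisson integrals. -/
theorem re_circleAverage_herglotzRieszKernel_le {u : ℂ → ℝ} {R : ℝ} {w : ℂ}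
    (hu : CircleIntegrable u 0 R) (hu0 : ∀ z, 0 ≤ u z) (hw : w ∈ ball (0 : ℂ) R) :
    (Real.circleAverage (fun ζ => herglotzRieszKernel 0 w ζ • (u ζ : ℂ)) 0 R).re ≤
      (R + ‖w‖) / (R - ‖w‖) * Real.circleAverage u 0 R := by
  have hR0 : 0 < R := pos_of_mem_ball hw
  rw [re_circleAverage_herglotzRieszKernel_smul hu hw, ← smul_eq_mul,
    ← Real.circleAverage_fun_smul]
  refine Real.circleAverage_mono ?_ ?_ fun z hz => ?_
  · refine hu.continuousOn_smul ?_
    exact Complex.continuous_re.comp_continuousOn (continuousOn_herglotzRieszKernel_sphere hw)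
  · exact hu.const_fun_smul
  · rw [abs_of_pos hR0] at hz
    have := re_herglotzRieszKernel_le hz hw
    simp only [sub_zero] at this
    simp only [Pi.smul_apply', Function.comp_apply, smul_eq_mul, herglotzRieszKernel_def, sub_zero]
    exact mul_le_mul_of_nonneg_right this (hu0 z)

/-- **Littlewood subordination**: composition with a holomorphic self-map preserves `H²`. -/
theorem MemH2.comp_selfMap {g φ : ℂ → ℂ} (hg : MemH2 g) (hφ : IsHolomorphicSelfMap φ) :
    MemH2 fun z => g (φ z) := by
  obtain ⟨hgd, C, hC⟩ := memH2_iff_circleAverage.1 hg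
  have hcd : DifferentiableOn ℂ (fun z => g (φ z)) disc := hgd.comp hφ.1 hφ.2
  have hφ0 : ‖φ 0‖ < 1 := by simpa using hφ.2 (mem_ball_self one_pos)
  have hC0 : 0 ≤ C := (Real.circleAverage_nonneg_of_nonneg fun z _ => by positivity).trans
    (hC 0 le_rfl one_pos)
  refine memH2_iff_circleAverage.2 ⟨hcd, 2 / ((1 - ‖φ 0‖) / 2) * C, fun r h0 h1 => ?_⟩
  have hsub : closedBall (0 : ℂ) r ⊆ disc := closedBall_subset_ball h1
  obtain ⟨z₁, hz₁, hmax⟩ := (isCompact_closedBall (0 : ℂ) r).exists_isMaxOn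
    (nonempty_closedBall.2 h0) (hφ.1.continuousOn.mono hsub).norm
  have hz₁' : ‖φ z₁‖ < 1 := by simpa using hφ.2 (hsub hz₁)
  -- `R` may depend on `r`, but it stays at distance at least `(1 - ‖φ 0‖) / 2` from `‖φ 0‖`, so the
  -- final Harnack constant does not.
  obtain ⟨R, hR, hR1⟩ := exists_between (max_lt hz₁' (show (1 + ‖φ 0‖) / 2 < 1 by linarith))
  have hRa : ‖φ z₁‖ < R := (le_max_left _ _).trans_lt hR
  have hRb : (1 + ‖φ 0‖) / 2 < R := (le_max_right _ _).trans_lt hR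
  have hR0 : 0 < R := (norm_nonneg _).trans_lt hRa
  have hmaps : Set.MapsTo φ (closedBall 0 r) (ball 0 R) := fun z hz => by
    simpa using (hmax hz : ‖φ z‖ ≤ ‖φ z₁‖).trans_lt hRa
  have hint : CircleIntegrable (fun z => ‖g z‖ ^ 2) 0 R :=
    circleIntegrable_of_continuousOn_disc (hgd.continuousOn.norm.pow 2) hR0.le hR1
  have hintC : CircleIntegrable (fun z => ((‖g z‖ ^ 2 : ℝ) : ℂ)) 0 R :=
    circleIntegrable_of_continuousOn_disc
      (Complex.continuous_ofReal.comp_continuousOn (hgd.continuousOn.norm.pow 2)) hR0.le hR1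
  -- `Re H` is a harmonic majorant of `‖g‖ ^ 2`. Since `H` itself is holomorphic, the mean value
  -- property of `H ∘ φ` comes from the holomorphic one.
  set H : ℂ → ℂ := fun w => Real.circleAverage
    (fun ζ => herglotzRieszKernel 0 w ζ • ((‖g ζ‖ ^ 2 : ℝ) : ℂ)) 0 R with hH
  have hHd : DifferentiableOn ℂ H (ball 0 R) :=
    differentiableOn_circleAverage_herglotzRieszKernel_smul hintC
  have hHφ : DifferentiableOn ℂ (H ∘ φ) (closedBall 0 r) := hHd.comp (hφ.1.mono hsub) hmaps
  have hsph : sphere (0 : ℂ) r ⊆ closedBall 0 r := sphere_subset_closedBall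
  have hHi : CircleIntegrable (H ∘ φ) 0 r :=
    (hHφ.continuousOn.mono hsph).circleIntegrable h0
  calc Real.circleAverage (fun z => ‖g (φ z)‖ ^ 2) 0 r
      ≤ Real.circleAverage (Complex.reCLM ∘ (H ∘ φ)) 0 r := by
        refine Real.circleAverage_mono ?_ ?_ fun z hz => ?_
        · exact circleIntegrable_of_continuousOn_disc (hcd.continuousOn.norm.pow 2) h0 h1
        · exact (Complex.continuous_re.comp_continuousOn
            (hHφ.continuousOn.mono hsph)).circleIntegrable h0
        · rw [abs_of_nonneg h0] at hz
          exact norm_sq_le_re_circleAverage_herglotzRieszKernel hgd hR1 (hmaps (hsph hz))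
    _ = (H (φ 0)).re := by
        rw [Complex.reCLM.circleAverage_comp_comm hHi, DiffContOnCl.circleAverage]
        · rfl
        · rw [abs_of_nonneg h0]
          exact (hHφ.mono closure_ball_subset_closedBall).diffContOnCl
    _ ≤ (R + ‖φ 0‖) / (R - ‖φ 0‖) * Real.circleAverage (fun z => ‖g z‖ ^ 2) 0 R :=
        re_circleAverage_herglotzRieszKernel_le hint (fun z => by positivity)
          (hmaps (mem_closedBall_self h0))
    _ ≤ 2 / ((1 - ‖φ 0‖) / 2) * C := by
        have h2 : 0 < (1 - ‖φ 0‖) / 2 := by linarith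
        have h3 : 0 < R - ‖φ 0‖ := by linarith
        refine mul_le_mul ?_ (hC R hR0.le hR1)
          (Real.circleAverage_nonneg_of_nonneg fun z _ => by positivity) (by positivity)
        exact div_le_div₀ (by norm_num) (by linarith) h2 (by linarith)

/-! ### Division of holomorphic functions -/

/-- The quotient `F / B` is meromorphic of nonnegative order everywhere, so its singularities are
removable; the meromorphic normal form fills them in. -/
theorem AnalyticOnNhd.exists_eq_mul_of_analyticOrderAt_le {U : Set ℂ} {B F : ℂ → ℂ}
    (hB : AnalyticOnNhd ℂ B U) (hF : AnalyticOnNhd ℂ F U)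
    (hne : ∀ w ∈ U, ∀ᶠ z in 𝓝[≠] w, B z ≠ 0)
    (hord : ∀ w ∈ U, analyticOrderAt B w ≤ analyticOrderAt F w) :
    ∃ G : ℂ → ℂ, AnalyticOnNhd ℂ G U ∧ ∀ z ∈ U, F z = B z * G z := by
  have hm : MeromorphicOn (F / B) U := hF.meromorphicOn.div hB.meromorphicOn
  have hG : AnalyticOnNhd ℂ (toMeromorphicNFOn (F / B) U) U := fun w hw => by
    rw [← (meromorphicNFOn_toMeromorphicNFOn (F / B) U hw).meromorphicOrderAt_nonneg_iff_analyticAt,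
      meromorphicOrderAt_toMeromorphicNFOn hm hw,
      meromorphicOrderAt_div (hF w hw).meromorphicAt (hB w hw).meromorphicAt,
      (hF w hw).meromorphicOrderAt_eq, (hB w hw).meromorphicOrderAt_eq]
    have h1 := hord w hw
    have h2 : analyticOrderAt B w ≠ ⊤ := fun h => by
      have h3 := (analyticOrderAt_eq_top.1 h).filter_mono (nhdsWithin_le_nhds (s := {w}ᶜ))
      obtain ⟨z, hz, hz'⟩ := (h3.and (hne w hw)).exists
      exact hz' hz
    obtain ⟨n, hn⟩ := ENat.ne_top_iff_exists.1 h2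
    rw [← hn] at h1 ⊢
    cases hf : analyticOrderAt F w with
    | top => exact le_top
    | coe k =>
      rw [hf] at h1
      simp only [ENat.map_natCast]
      have h4 : (n : ℤ) ≤ k := by exact_mod_cast h1
      change ((0 : ℤ) : WithTop ℤ) ≤ (((k : ℤ) - (n : ℤ) : ℤ) : WithTop ℤ)
      exact_mod_cast sub_nonneg.2 h4
  refine ⟨_, hG, fun w hw => ?_⟩
  have hev : F =ᶠ[𝓝[≠] w] fun z => B z * toMeromorphicNFOn (F / B) U z := by
    filter_upwards [hm.toMeromorphicNFOn_eq_self_on_nhdsNE hw, hne w hw] with z h1 h2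
    rw [h1, Pi.div_apply, mul_div_cancel₀ _ h2]
  -- Both sides are continuous at `w`, so equality on a punctured neighbourhood reaches `w`.
  exact ((hF w hw).continuousAt.eventuallyEq_nhds_iff_eventuallyEq_nhdsNE
    ((hB w hw).mul (hG w hw)).continuousAt).1 hev |>.eq_of_nhds

/-! ### Blaschke products -/

theorem one_sub_conj_mul_ne_zero {a z : ℂ} (ha : a ∈ disc) (hz : z ∈ disc) :
    1 - (starRingEnd ℂ) a * z ≠ 0 := by
  simp only [disc, mem_ball, dist_zero_right] at ha hz
  intro h
  have h1 : ‖(starRingEnd ℂ) a * z‖ = 1 := by rw [← sub_eq_zero.1 h, norm_one]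
  rw [norm_mul, RCLike.norm_conj] at h1
  nlinarith [norm_nonneg a, norm_nonneg z]

theorem differentiableOn_blaschkeFactor {a : ℂ} (ha : a ∈ disc) :
    DifferentiableOn ℂ (blaschkeFactor a) disc := by
  unfold blaschkeFactor
  exact ((by fun_prop : DifferentiableOn ℂ (fun z => a - z) disc).div (by fun_prop)
    fun z hz => one_sub_conj_mul_ne_zero ha hz).const_mul _

theorem blaschkeFactor_ne_zero {a z : ℂ} (h0 : a ≠ 0) (ha : a ∈ disc) (hz : z ∈ disc)
    (hza : z ≠ a) : blaschkeFactor a z ≠ 0 := by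
  have := one_sub_conj_mul_ne_zero ha hz
  simp [blaschkeFactor, h0, this, sub_eq_zero, hza.symm]

theorem one_sub_norm_sq_blaschkeFactor {a z : ℂ} (h0 : a ≠ 0) (ha : a ∈ disc) (hz : z ∈ disc) :
    1 - ‖blaschkeFactor a z‖ ^ 2 =
      (1 - ‖a‖ ^ 2) * (1 - ‖z‖ ^ 2) / ‖1 - (starRingEnd ℂ) a * z‖ ^ 2 := by
  have hd := norm_ne_zero_iff.2 (one_sub_conj_mul_ne_zero ha hz)
  have hn := norm_ne_zero_iff.2 h0
  have : ‖blaschkeFactor a z‖ = ‖a - z‖ / ‖1 - (starRingEnd ℂ) a * z‖ := by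
    simp [blaschkeFactor, hn]
  rw [this, div_pow, one_sub_div (pow_ne_zero 2 hd)]
  congr 1
  simp only [← Complex.normSq_eq_norm_sq, Complex.normSq_apply, Complex.sub_re, Complex.sub_im,
    Complex.mul_re, Complex.mul_im, Complex.conj_re, Complex.conj_im, Complex.one_re,
    Complex.one_im]
  ring

/-- The filter encodes `‖z‖ → 1⁻` uniformly in the argument of `z`, as the maximum principle on
circles requires. In the formula for `1 - ‖blaschkeFactor a z‖ ^ 2` the denominator stays away from
0. -/
theorem tendsto_norm_blaschkeFactor {a : ℂ} (h0 : a ≠ 0) (ha : a ∈ disc) :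
    Tendsto (fun z => ‖blaschkeFactor a z‖) (comap (‖·‖) (𝓝[<] (1 : ℝ))) (𝓝 1) := by
  have hn : Tendsto (fun z : ℂ => ‖z‖) (comap (‖·‖) (𝓝[<] (1 : ℝ))) (𝓝[<] 1) := tendsto_comap
  have hdisc : ∀ᶠ z : ℂ in comap (‖·‖) (𝓝[<] (1 : ℝ)), z ∈ disc := by
    filter_upwards [hn.eventually self_mem_nhdsWithin] with z hz
    simpa using hz
  have ha' : ‖a‖ < 1 := by simpa using ha
  have hsq : Tendsto (fun z => 1 - ‖blaschkeFactor a z‖ ^ 2)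
      (comap (‖·‖) (𝓝[<] (1 : ℝ))) (𝓝 0) := by
    have hlim : Tendsto (fun z : ℂ => (1 - ‖a‖ ^ 2) * (1 - ‖z‖ ^ 2) / (1 - ‖a‖) ^ 2)
        (comap (‖·‖) (𝓝[<] (1 : ℝ))) (𝓝 ((1 - ‖a‖ ^ 2) * (1 - 1 ^ 2) / (1 - ‖a‖) ^ 2)) :=
      (((hn.mono_right nhdsWithin_le_nhds).pow 2).const_sub 1 |>.const_mul _).div_const _
    rw [one_pow, sub_self, mul_zero, zero_div] at hlim
    refine squeeze_zero' ?_ ?_ hlim <;> filter_upwards [hdisc] with z hz <;>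
      rw [one_sub_norm_sq_blaschkeFactor h0 ha hz] <;>
      have hz' : ‖z‖ < 1 := by simpa using hz
    · have h1 : 0 ≤ 1 - ‖a‖ ^ 2 := by nlinarith [norm_nonneg a]
      have h2 : 0 ≤ 1 - ‖z‖ ^ 2 := by nlinarith [norm_nonneg z]
      positivity
    · have h1 : 0 ≤ 1 - ‖a‖ ^ 2 := by nlinarith [norm_nonneg a]
      have h2 : 0 ≤ 1 - ‖z‖ ^ 2 := by nlinarith [norm_nonneg z]
      have h3 : 0 < 1 - ‖a‖ := by linarith
      have h4 : 1 - ‖a‖ ≤ ‖1 - (starRingEnd ℂ) a * z‖ := by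
        have h5 := norm_sub_norm_le (1 : ℂ) ((starRingEnd ℂ) a * z)
        rw [norm_one, norm_mul, RCLike.norm_conj] at h5
        nlinarith [norm_nonneg a]
      gcongr
  have h1 := (hsq.const_sub 1).sqrt
  simpa using h1

/-- A finite Blaschke product. -/
noncomputable def finiteBlaschke {ι : Type} (m : ℕ) (a : ι → ℂ) (S : Finset ι) (z : ℂ) : ℂ :=
  z ^ m * ∏ i ∈ S, blaschkeFactor (a i) z

section

variable {ι : Type} {m : ℕ} {a : ι → ℂ}

theorem tendsto_norm_finiteBlaschke (h0 : ∀ i, a i ≠ 0) (ha : ∀ i, a i ∈ disc) (S : Finset ι) :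
    Tendsto (fun z => ‖finiteBlaschke m a S z‖) (comap (‖·‖) (𝓝[<] (1 : ℝ))) (𝓝 1) := by
  have h1 : Tendsto (fun z : ℂ => ‖z‖ ^ m) (comap (‖·‖) (𝓝[<] (1 : ℝ))) (𝓝 (1 ^ m)) :=
    (tendsto_comap.mono_right nhdsWithin_le_nhds).pow m
  have h2 := h1.mul (tendsto_finsetProd S fun i _ => tendsto_norm_blaschkeFactor (h0 i) (ha i))
  simpa [finiteBlaschke] using h2

theorem differentiableOn_tprod_blaschkeFactor (h0 : ∀ i, a i ≠ 0) (ha : ∀ i, a i ∈ disc)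
    (hs : Summable fun i => 1 - ‖a i‖) :
    DifferentiableOn ℂ (fun z => ∏' i, blaschkeFactor (a i) z) disc := by
  intro w hw
  -- The bound `2 / (1 - ‖z‖)` blows up at the circle, so a uniform majorant exists only on smaller
  -- discs.
  obtain ⟨r, hwr, hr1⟩ := exists_between (show ‖w‖ < 1 by simpa using hw)
  have hsub : ball (0 : ℂ) r ⊆ disc := ball_subset_ball hr1.le
  have hp : HasProdLocallyUniformlyOn (fun i z => 1 + (blaschkeFactor (a i) z - 1))
      (fun z => ∏' i, (1 + (blaschkeFactor (a i) z - 1))) (ball 0 r) := by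
    refine Summable.hasProdLocallyUniformlyOn_one_add isOpen_ball (hs.mul_right (2 / (1 - r)))
      (Eventually.of_forall fun i z hz => ?_) fun i => ?_
    · refine (norm_blaschkeFactor_sub_one_le (h0 i) (ha i) (hsub hz)).trans ?_
      have h1 : ‖a i‖ < 1 := by simpa using ha i
      have h2 : ‖z‖ < r := by simpa using hz
      have h3 : 0 < 1 - r := by linarith
      have h4 : 0 ≤ 1 - ‖a i‖ := by linarith
      gcongr
    · exact ((differentiableOn_blaschkeFactor (ha i)).continuousOn.mono hsub).sub
        continuousOn_const
  simp only [add_sub_cancel] at hp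
  have hd : DifferentiableOn ℂ (fun z => ∏' i, blaschkeFactor (a i) z) (ball 0 r) := by
    refine TendstoLocallyUniformlyOn.differentiableOn
      (hasProdLocallyUniformlyOn_iff_tendstoLocallyUniformlyOn.1 hp)
      (Eventually.of_forall fun S => ?_) isOpen_ball
    exact DifferentiableOn.fun_finsetProd fun i _ =>
      (differentiableOn_blaschkeFactor (ha i)).mono hsub
  exact (hd.differentiableAt (isOpen_ball.mem_nhds (by simpa using hwr))).differentiableWithinAt

theorem analyticOnNhd_blaschkeProduct (h0 : ∀ i, a i ≠ 0) (ha : ∀ i, a i ∈ disc)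
    (hs : Summable fun i => 1 - ‖a i‖) : AnalyticOnNhd ℂ (blaschkeProduct m a) disc :=
  ((differentiableOn_id.pow m).mul
    (differentiableOn_tprod_blaschkeFactor h0 ha hs)).analyticOnNhd isOpen_ball

theorem tprod_blaschkeFactor_ne_zero (h0 : ∀ i, a i ≠ 0) (ha : ∀ i, a i ∈ disc)
    (hs : Summable fun i => 1 - ‖a i‖) {z : ℂ} (hz : z ∈ disc) (hza : ∀ i, z ≠ a i) :
    ∏' i, blaschkeFactor (a i) z ≠ 0 := by
  have := tprod_one_add_ne_zero_of_summable (f := fun i => blaschkeFactor (a i) z - 1)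
    (fun i => by simpa using blaschkeFactor_ne_zero (h0 i) (ha i) hz (hza i))
    (Summable.of_nonneg_of_le (fun _ => norm_nonneg _)
      (fun i => norm_blaschkeFactor_sub_one_le (h0 i) (ha i) hz) (hs.mul_right _))
  simpa using this

/-- Summability of nonzero terms makes the zeros countable, so they cannot fill the disc. -/
theorem exists_blaschkeProduct_ne_zero (h0 : ∀ i, a i ≠ 0) (ha : ∀ i, a i ∈ disc)
    (hs : Summable fun i => 1 - ‖a i‖) : ∃ z ∈ disc, blaschkeProduct m a z ≠ 0 := by
  have hpos : ∀ i, 1 - ‖a i‖ ≠ 0 := fun i => by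
    have : ‖a i‖ < 1 := by simpa using ha i
    linarith
  have hcount : Countable ι := by
    have := hs.countable_support
    rwa [Function.support_eq_univ hpos, Set.countable_univ_iff] at this
  have hd : Dense (insert 0 (Set.range a))ᶜ :=
    ((Set.countable_range a).insert 0).dense_compl ℝ
  obtain ⟨z, hz, hz'⟩ := hd.exists_mem_open isOpen_ball ⟨0, mem_ball_self (one_pos (α := ℝ))⟩
  simp only [Set.mem_compl_iff, Set.mem_insert_iff, Set.mem_range, not_or, not_exists] at hz
  exact ⟨z, hz', mul_ne_zero (pow_ne_zero _ hz.1)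
    (tprod_blaschkeFactor_ne_zero h0 ha hs hz' fun i h => hz.2 i h.symm)⟩

theorem eventually_blaschkeProduct_ne_zero (h0 : ∀ i, a i ≠ 0) (ha : ∀ i, a i ∈ disc)
    (hs : Summable fun i => 1 - ‖a i‖) {w : ℂ} (hw : w ∈ disc) :
    ∀ᶠ z in 𝓝[≠] w, blaschkeProduct m a z ≠ 0 := by
  by_contra hcon
  obtain ⟨z, hz, hne⟩ := exists_blaschkeProduct_ne_zero (m := m) h0 ha hs
  have hB := analyticOnNhd_blaschkeProduct (m := m) h0 ha hs
  refine hne (hB.eqOn_zero_of_preconnected_of_frequently_eq_zero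
    (convex_ball (0 : ℂ) 1).isPreconnected hw ?_ hz)
  exact fun h => hcon h

theorem blaschkeProduct_eq_finiteBlaschke_mul (h0 : ∀ i, a i ≠ 0) (ha : ∀ i, a i ∈ disc)
    (hs : Summable fun i => 1 - ‖a i‖) (S : Finset ι) {z : ℂ} (hz : z ∈ disc) :
    blaschkeProduct m a z = finiteBlaschke m a S z *
      ∏' i : ↑((S : Set ι)ᶜ), blaschkeFactor (a i) z := by
  have h1 : Multipliable ((fun i => blaschkeFactor (a i) z) ∘ (↑) : ((S : Set ι) : Type) → ℂ) :=
    multipliable_blaschkeFactor (a := fun i : (S : Set ι) => a i) (fun i => h0 i) (fun i => ha i)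
      (hs.subtype _) hz
  have h2 : Multipliable ((fun i => blaschkeFactor (a i) z) ∘ (↑) : ↑((S : Set ι)ᶜ) → ℂ) :=
    multipliable_blaschkeFactor (a := fun i : ↑((S : Set ι)ᶜ) => a i) (fun i => h0 i)
      (fun i => ha i) (hs.subtype _) hz
  rw [blaschkeProduct, finiteBlaschke, ← Multipliable.tprod_mul_tprod_compl h1 h2, mul_assoc]
  congr 2
  exact S.tprod_subtype fun i => blaschkeFactor (a i) z

/-- The Schwarz lemma for finite Blaschke products. -/
theorem norm_le_norm_finiteBlaschke (h0 : ∀ i, a i ≠ 0) (ha : ∀ i, a i ∈ disc) (S : Finset ι)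
    {F G : ℂ → ℂ} (hF : ∀ z ∈ disc, ‖F z‖ ≤ 1) (hG : DifferentiableOn ℂ G disc)
    (hFG : ∀ z ∈ disc, F z = finiteBlaschke m a S z * G z) {z : ℂ} (hz : z ∈ disc) :
    ‖F z‖ ≤ ‖finiteBlaschke m a S z‖ := by
  suffices h : ‖G z‖ ≤ 1 by
    rw [hFG z hz, norm_mul]
    exact mul_le_of_le_one_right (norm_nonneg _) h
  have hz' : ‖z‖ < 1 := by simpa using hz
  -- On a circle close to the boundary the finite product exceeds `c` in modulus, so `‖G‖ ≤ c⁻¹`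
  -- there and, by the maximum principle, at `z`; then `c → 1`.
  have key : ∀ c : ℝ, 0 < c → c < 1 → ‖G z‖ ≤ c⁻¹ := fun c hc0 hc1 => by
    have hev := (tendsto_norm_finiteBlaschke (m := m) h0 ha S).eventually (lt_mem_nhds hc1)
    rw [eventually_comap] at hev
    obtain ⟨r, hr, hr0, hr1⟩ := (hev.and (Ioo_mem_nhdsLT hz')).exists
    have hr0' : 0 < r := (norm_nonneg z).trans_lt hr0
    have hsub : closedBall (0 : ℂ) r ⊆ disc := closedBall_subset_ball hr1
    refine Complex.norm_le_of_forall_mem_frontier_norm_le (isBounded_ball (x := (0 : ℂ)) (r := r))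
      (hG.mono (closure_ball_subset_closedBall.trans hsub)).diffContOnCl (fun w hw => ?_)
      (subset_closure (by simpa using hr0))
    rw [frontier_ball _ hr0'.ne'] at hw
    have hwd : w ∈ disc := hsub (sphere_subset_closedBall hw)
    have h1 := hF w hwd
    have h2 : c < ‖finiteBlaschke m a S w‖ := hr w (by simpa using hw)
    rw [hFG w hwd, norm_mul] at h1
    rw [inv_eq_one_div, le_div_iff₀' hc0]
    exact (mul_le_mul_of_nonneg_right h2.le (norm_nonneg _)).trans h1
  have hlim : Tendsto (fun c : ℝ => c⁻¹) (𝓝[<] 1) (𝓝 1⁻¹) :=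
    (tendsto_inv₀ one_ne_zero).mono_left nhdsWithin_le_nhds
  rw [inv_one] at hlim
  refine ge_of_tendsto hlim ?_
  filter_upwards [Ioo_mem_nhdsLT (one_pos (α := ℝ))] with c hc using key c hc.1 hc.2

/-- A holomorphic function bounded by one that vanishes at the zeros of a Blaschke product, to at
least the same orders, is the product of the Blaschke product and a function bounded by one. -/
theorem exists_eq_blaschkeProduct_mul (h0 : ∀ i, a i ≠ 0) (ha : ∀ i, a i ∈ disc)
    (hs : Summable fun i => 1 - ‖a i‖) {F : ℂ → ℂ} (hFd : DifferentiableOn ℂ F disc)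
    (hF : ∀ z ∈ disc, ‖F z‖ ≤ 1)
    (hord : ∀ w ∈ disc, analyticOrderAt (blaschkeProduct m a) w ≤ analyticOrderAt F w) :
    ∃ h : ℂ → ℂ, DifferentiableOn ℂ h disc ∧ (∀ z ∈ disc, ‖h z‖ ≤ 1) ∧
      ∀ z ∈ disc, F z = blaschkeProduct m a z * h z := by
  have hB := analyticOnNhd_blaschkeProduct (m := m) h0 ha hs
  obtain ⟨h, hh, hFh⟩ := hB.exists_eq_mul_of_analyticOrderAt_le
    (hFd.analyticOnNhd isOpen_ball) (fun w hw => eventually_blaschkeProduct_ne_zero h0 ha hs hw)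
    hord
  have hle : ∀ z ∈ disc, ‖F z‖ ≤ ‖blaschkeProduct m a z‖ := fun z hz => by
    have hlim : Tendsto (fun S => ‖finiteBlaschke m a S z‖) atTop
        (𝓝 ‖blaschkeProduct m a z‖) :=
      ((multipliable_blaschkeFactor h0 ha hs hz).hasProd.const_mul (z ^ m)).norm
    refine ge_of_tendsto' hlim fun S => ?_
    -- The infinite tail of the product is absorbed into the cofactor.
    refine norm_le_norm_finiteBlaschke h0 ha S hF (G := fun z =>
      (∏' i : ↑((S : Set ι)ᶜ), blaschkeFactor (a i) z) * h z) ?_ (fun w hw => ?_) hz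
    · exact (differentiableOn_tprod_blaschkeFactor (a := fun i : ↑((S : Set ι)ᶜ) => a i)
        (fun i => h0 i) (fun i => ha i) (hs.subtype _)).mul hh.differentiableOn
    · rw [hFh w hw, blaschkeProduct_eq_finiteBlaschke_mul h0 ha hs S hw, mul_assoc]
  refine ⟨h, hh.differentiableOn, fun w hw => ?_, hFh⟩
  -- Dividing by `B` is possible only off its zeros; these are isolated, so continuity of `h` covers
  -- them.
  have hev : ∀ᶠ z in 𝓝[≠] w, ‖h z‖ ≤ 1 := by
    filter_upwards [eventually_blaschkeProduct_ne_zero (m := m) h0 ha hs hw,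
      nhdsWithin_le_nhds (isOpen_ball.mem_nhds hw)] with z hz hzd
    have h1 := hle z hzd
    rw [hFh z hzd, norm_mul] at h1
    exact le_of_mul_le_mul_left (by linarith) (norm_pos_iff.2 hz)
  exact le_of_tendsto ((hh w hw).continuousAt.norm.tendsto.mono_left nhdsWithin_le_nhds) hev

theorem norm_blaschkeFactor_le_one (h0 : ∀ i, a i ≠ 0) (ha : ∀ i, a i ∈ disc) {z : ℂ}
    (hz : z ∈ disc) (i : ι) : ‖blaschkeFactor (a i) z‖ ≤ 1 := by
  have h1 := one_sub_norm_sq_blaschkeFactor (h0 i) (ha i) hz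
  have h2 : ‖a i‖ < 1 := by simpa using ha i
  have h3 : ‖z‖ < 1 := by simpa using hz
  have h4 : 0 ≤ 1 - ‖a i‖ ^ 2 := by nlinarith [norm_nonneg (a i)]
  have h5 : 0 ≤ 1 - ‖z‖ ^ 2 := by nlinarith [norm_nonneg z]
  have h6 : 0 ≤ 1 - ‖blaschkeFactor (a i) z‖ ^ 2 := by rw [h1]; positivity
  nlinarith [norm_nonneg (blaschkeFactor (a i) z)]

theorem norm_blaschkeProduct_le_one (h0 : ∀ i, a i ≠ 0) (ha : ∀ i, a i ∈ disc)
    (hs : Summable fun i => 1 - ‖a i‖) {z : ℂ} (hz : z ∈ disc) : ‖blaschkeProduct m a z‖ ≤ 1 := by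
  have hlim : Tendsto (fun S => ‖finiteBlaschke m a S z‖) atTop (𝓝 ‖blaschkeProduct m a z‖) :=
    ((multipliable_blaschkeFactor h0 ha hs hz).hasProd.const_mul (z ^ m)).norm
  refine le_of_tendsto' hlim fun S => ?_
  rw [finiteBlaschke, norm_mul, norm_pow, norm_prod]
  have hz' : ‖z‖ < 1 := by simpa using hz
  exact mul_le_one₀ (pow_le_one₀ (norm_nonneg _) hz'.le)
    (Finset.prod_nonneg fun _ _ => norm_nonneg _)
    (Finset.prod_le_one (fun _ _ => norm_nonneg _)
      fun i _ => norm_blaschkeFactor_le_one h0 ha hz i)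

end

theorem corollary2p3 (B φ : ℂ → ℂ) (hB : IsBlaschkeProduct B) (hφ : IsHolomorphicSelfMap φ) :
    (∀ f ∈ mulH2 B, compOperator φ f ∈ mulH2 B) ↔
      ∀ w ∈ disc, B w = 0 →
        analyticOrderAt B w ≤ analyticOrderAt (compOperator φ B) w := by
  obtain ⟨ι, m, a, h0, ha, hs, hBeq⟩ := hB
  have hev : ∀ w ∈ disc, B =ᶠ[𝓝 w] blaschkeProduct m a := fun w hw => by
    filter_upwards [isOpen_ball.mem_nhds hw] with z hz using hBeq z hz
  have hBan : AnalyticOnNhd ℂ B disc := fun w hw =>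
    (analyticOnNhd_blaschkeProduct h0 ha hs w hw).congr (hev w hw).symm
  constructor
  · intro h w hw _
    obtain ⟨g, hg, hBg⟩ := h B ⟨fun _ => 1, memH2_one, fun z _ => (mul_one _).symm⟩
    have hev' : compOperator φ B =ᶠ[𝓝 w] B * g := by
      filter_upwards [isOpen_ball.mem_nhds hw] with z hz using hBg z hz
    rw [analyticOrderAt_congr hev', analyticOrderAt_mul (hBan w hw)
      (hg.differentiableOn.analyticOnNhd isOpen_ball w hw)]
    exact le_self_add
  · rintro h f ⟨g, hg, hfg⟩
    obtain ⟨b, hbd, hb1, hb⟩ := exists_eq_blaschkeProduct_mul (m := m) h0 ha hs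
      (F := compOperator φ B) (hBan.differentiableOn.comp hφ.1 hφ.2)
      (fun z hz => by
        rw [compOperator, Function.comp_apply, hBeq _ (hφ.2 hz)]
        exact norm_blaschkeProduct_le_one h0 ha hs (hφ.2 hz))
      (fun w hw => by
        rw [← analyticOrderAt_congr (hev w hw)]
        -- Where `B` does not vanish its order is 0, so a condition at the zeros alone suffices.
        by_cases hBw : B w = 0
        · exact h w hw hBw
        · rw [(hBan w hw).analyticOrderAt_eq_zero.2 hBw]
          exact zero_le)
    refine ⟨fun z => b z * g (φ z), (hg.comp_selfMap hφ).mul_bounded hbd hb1, fun z hz => ?_⟩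
    have h1 : B (φ z) = blaschkeProduct m a z * b z := hb z hz
    rw [compOperator, Function.comp_apply, hfg _ (hφ.2 hz), h1, hBeq z hz, mul_assoc]
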